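/- **Setting.** Let $N_T,N_R,M,N\ge 1$ and $L\ge N_R$ be integers and let $\mu_R,\mu_T\in[0,1]$ with $\mu_R+N_T\mu_T\ge 1$. A library consists of $L$ independent files $W_1,\dots,W_L$, each uniformly distributed on $[2^F]$ ($F$ bits), where $[n]=\{1,\dots,n\}$. There are $N_T$ transmitters with $M$ antennas each and $N_R$ receivers with $N$ antennas each. The channel ${\bf H}$ consists of complex matrices ${\bf H}_{ji}\in\mathbb C^{N\times M}$ (from transmitter $i$ to receiver $j$) whose entries are all independent and identically distributed with a distribution on $\mathbb C$ that has no atoms; it is known everywhere and constant during a transmission. A *scheme* specifies, for every power $P\geq 0$ and every file size $F$: caching functions $U_i=\phi_i(W_1,\dots,W_L)\in[2^{\lfloor F\mu_TL\rfloor}]$ of the transmitters and $V_j=\psi_j(W_1,\dots,W_L)\in[2^{\lfloor F\mu_RL\rfloor}]$ of the receivers, with arbitrary coding inside each file but no coding across files (each cached content is a one-to-one labelling of a tuple whose $l$-th entry is a function of $W_l$ only and ranges over a finite alphabet); for every demand vector ${\bf d}\in[L]^{N_R}$ and channel ${\bf H}$, a block length $T=T({\bf d},{\bf H})$; encoders that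 map $(U_i,{\bf d},{\bf H})$ to signals ${\bf x}_i(1),\dots,{\bf x}_i(T)\in\mathbb C^M$ with $\|{\bf x}_i(t)\|^2\le P$ for all $t$; and decoders that map $(V_j,{\bf y}_j(1),\dots,{\bf y}_j(T),{\bf H},{\bf d})$ to an estimate $\hat W_j$ of $W_{d_j}$, measurably in the received signal $${\bf y}_j(t)=\sum_{i=1}^{N_T}{\bf H}_{ji}{\bf x}_i(t)+{\bf n}_j(t),$$ where the entries of the noise vectors ${\bf n}_j(t)$ are independent of each other and of the files, circularly symmetric complex Gaussian with mean zero and unit variance. The scheme is *feasible* if for almost every ${\bf H}$, for all sufficiently large $P$, the worst-case error probability $\max_{\bf d}\max_j\mathbb P(\hat W_j\ne W_{d_j})$ tends to $0$ as $F\to\infty$. Its *normalized delivery time* (NDT) on the channel ${\bf H}$ is $$\lim_{P\to\infty}\ \limsup_{F\to\infty}\ \frac{\max_{\bf d}T({\bf d},{\bf H})}{F/\log_2 P}$$ if this limit exists in $[-\infty,\infty]$. A number $\tau$ is *achievable* if there is a feasible scheme that has, for almost every ${\bf H}$, an NDT, and one that is at most $\tau$. The *minimum NDT* $\tau^*(\mu_R,\mu_T)$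 is the infimum, in $[-\infty,\infty]$, of all achievable $\tau\in[-\infty,\infty]$. **Theorem 3** (lower bound for $N_T\times N_R$ networks). The minimum NDT satisfies $$\tau^*(\mu_R,\mu_T)\ \ge\ \max\left\{\frac{1}{N}(1-\mu_R),\ \max_{s\in[N_R]}\frac{s}{N_TM}(1-s\mu_R)\right\}.$$ -/

import Mathlib

open MeasureTheory ProbabilityTheory Filter Topology
open scoped NNReal ENNReal

noncomputable section

namespace CacheMIMO

/-- Number `⌊F Q⌋` of bits of a cache of normalized size `μ`, i.e. `Q = μ L`, for a library of
`L` files of `F` bits each. -/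
def cacheBits (μ : ℝ) (L F : ℕ) : ℕ := ⌊(F : ℝ) * (μ * (L : ℝ))⌋₊

/-- A library of `L` files of `F` bits: a point of `[2^F]^L`. -/
abbrev Library (L F : ℕ) : Type := Fin L → Fin (2 ^ F)

/-- Demand vectors: receiver `j` requests the file with index `d j`. -/
abbrev Demand (NR L : ℕ) : Type := Fin NR → Fin L

/-- Channel state: `H (j, i, n, m)` is the complex gain from antenna `m` of transmitter `i` to
antenna `n` of receiver `j`. -/
abbrev Channel (NT NR M N : ℕ) : Type := Fin NR × Fin NT × Fin N × Fin M → ℂ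

/-- The caching function `φ` does not code across files (arbitrary coding inside each file is
allowed): the cached content is a one-to-one labelling `e` of the tuple of the contents
`c l (W l)`, the `l`-th of which is a function of file `l` only, with values in an alphabet of
size `k l`. -/
def NoInterFileCoding {L F b : ℕ} (φ : Library L F → Fin (2 ^ b)) : Prop :=
  ∃ (k : Fin L → ℕ) (c : ∀ l, Fin (2 ^ F) → Fin (k l)) (e : (∀ l, Fin (k l)) → Fin (2 ^ b)),
    Function.Injective e ∧ ∀ W, φ W = e (fun l => c l (W l))

/-- A caching and coding scheme for file size `F` and transmit power `P`. -/
structure Code (NT NR M N L : ℕ) (μR μT : ℝ) (P : ℝ≥0) (F : ℕ) where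
  /-- caching functions of the transmitters -/
  txCache : Fin NT → Library L F → Fin (2 ^ cacheBits μT L F)
  /-- caching functions of the receivers -/
  rxCache : Fin NR → Library L F → Fin (2 ^ cacheBits μR L F)
  txCache_intra : ∀ i, NoInterFileCoding (txCache i)
  rxCache_intra : ∀ j, NoInterFileCoding (rxCache j)
  /-- block length, depending on the demands and on the channel -/
  T : Demand NR L → Channel NT NR M N → ℕ
  /-- encoding functions: transmitter `i` maps its cache content, the demands and the channel to
  the signal vectors of the `T` slots -/
  enc : Fin NT → Fin (2 ^ cacheBits μT L F) → ∀ (d : Demand NR L) (H : Channel NT NR M N),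
    Fin (T d H) → Fin M → ℂ
  /-- power constraint of every transmitter in every slot -/
  enc_power : ∀ i u d H t, ∑ m, ‖enc i u d H t m‖ ^ 2 ≤ (P : ℝ)
  /-- decoding functions: receiver `j` uses its cache content, the demands, the channel and the
  signal received on its `N` antennas in the `T` slots -/
  dec : Fin NR → Fin (2 ^ cacheBits μR L F) → ∀ (d : Demand NR L) (H : Channel NT NR M N),
    (Fin N → Fin (T d H) → ℂ) → Fin (2 ^ F)
  dec_measurable : ∀ j v d H, Measurable (dec j v d H)

/-- Circularly symmetric complex Gaussian law with mean zero and unit variance. -/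
def complexGaussian : Measure ℂ :=
  ((gaussianReal 0 (1 / 2)).prod (gaussianReal 0 (1 / 2))).map
    (fun p : ℝ × ℝ => (⟨p.1, p.2⟩ : ℂ))

/-- Law of the noise at all receive antennas during `T` slots: independent entries. -/
def noiseLaw (NR N T : ℕ) : Measure (Fin NR × Fin N × Fin T → ℂ) :=
  Measure.pi (fun _ => complexGaussian)

/-- Law of the library: independent, uniformly distributed files. -/
def libraryLaw (L F : ℕ) : Measure (Library L F) := uniformOn Set.univ

/-- Law of the channel when its entries are independent with law `ν`. -/
def channelLaw (NT NR M N : ℕ) (ν : Measure ℂ) : Measure (Channel NT NR M N) :=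
  Measure.pi (fun _ => ν)

namespace Code

variable {NT NR M N L F : ℕ} {μR μT : ℝ} {P : ℝ≥0}

/-- Signal received by receiver `j` on antenna `n` in slot `t`, for the library `W` and the
noise `z`. -/
def received (C : Code NT NR M N L μR μT P F) (d : Demand NR L) (H : Channel NT NR M N)
    (W : Library L F) (z : Fin NR × Fin N × Fin (C.T d H) → ℂ) (j : Fin NR) (n : Fin N)
    (t : Fin (C.T d H)) : ℂ :=
  (∑ i, ∑ m, H (j, i, n, m) * C.enc i (C.txCache i W) d H t m) + z (j, n, t)

/-- The file that receiver `j` outputs. -/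
def estimate (C : Code NT NR M N L μR μT P F) (d : Demand NR L) (H : Channel NT NR M N)
    (j : Fin NR) (W : Library L F) (z : Fin NR × Fin N × Fin (C.T d H) → ℂ) : Fin (2 ^ F) :=
  C.dec j (C.rxCache j W) d H (C.received d H W z j)

/-- Probability, over the library and the noise, that receiver `j` errs. -/
def errorProb (C : Code NT NR M N L μR μT P F) (H : Channel NT NR M N) (d : Demand NR L)
    (j : Fin NR) : ℝ≥0∞ :=
  ((libraryLaw L F).prod (noiseLaw NR N (C.T d H)))
    {p | C.estimate d H j p.1 p.2 ≠ p.1 (d j)}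

/-- Worst-case error probability over the demands and the receivers. -/
def worstErrorProb (C : Code NT NR M N L μR μT P F) (H : Channel NT NR M N) : ℝ≥0∞ :=
  ⨆ (d : Demand NR L) (j : Fin NR), C.errorProb H d j

/-- Block length for the worst demand vector. -/
def maxT (C : Code NT NR M N L μR μT P F) (H : Channel NT NR M N) : ℕ :=
  Finset.univ.sup (fun d => C.T d H)

end Code

/-- A scheme: a code for every power `P` and every file size `F`. -/
abbrev Scheme (NT NR M N L : ℕ) (μR μT : ℝ) : Type :=
  ∀ (P : ℝ≥0) (F : ℕ), Code NT NR M N L μR μT P F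

namespace Scheme

variable {NT NR M N L : ℕ} {μR μT : ℝ}

/-- For almost all channels, at every large enough power, the worst-case error probability tends
to zero as the file size grows. -/
def Feasible (S : Scheme NT NR M N L μR μT) (ν : Measure ℂ) : Prop :=
  ∀ᵐ H ∂(channelLaw NT NR M N ν), ∀ᶠ P : ℝ≥0 in atTop,
    Tendsto (fun F : ℕ => (S P F).worstErrorProb H) atTop (𝓝 0)

/-- Worst-case block length relative to the time `F / log₂ P`. -/
def relTime (S : Scheme NT NR M N L μR μT) (H : Channel NT NR M N) (P : ℝ≥0) (F : ℕ) : EReal :=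
  ((((S P F).maxT H : ℝ) / ((F : ℝ) / Real.logb 2 (P : ℝ)) : ℝ) : EReal)

/-- The scheme has normalized delivery time `τ` on the channel `H`: the limit as `P → ∞` of the
upper limit as `F → ∞` of the relative delivery time is `τ`. -/
def HasNDT (S : Scheme NT NR M N L μR μT) (H : Channel NT NR M N) (τ : EReal) : Prop :=
  Tendsto (fun P : ℝ≥0 => limsup (fun F : ℕ => S.relTime H P F) atTop) atTop (𝓝 τ)

end Scheme

/-- `τ` is achievable: some feasible scheme has, on almost all channels, a normalized delivery
time, and one that is at most `τ`. -/
def Achievable (NT NR M N L : ℕ) (μR μT : ℝ) (ν : Measure ℂ) (τ : EReal) : Prop :=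
  ∃ S : Scheme NT NR M N L μR μT, S.Feasible ν ∧
    ∀ᵐ H ∂(channelLaw NT NR M N ν), ∃ l : EReal, l ≤ τ ∧ S.HasNDT H l

/-- The minimum normalized delivery time. -/
def minNDT (NT NR M N L : ℕ) (μR μT : ℝ) (ν : Measure ℂ) : EReal :=
  sInf {τ | Achievable NT NR M N L μR μT ν τ}

end CacheMIMO

end

/-! The converse is a count of libraries on one fixed channel. Suppose the noiseless signals of the
first `s` receivers are linear images of `K` complex numbers per slot, of modulus O(√P). Over `T`
slots they lie, coordinatewise, within bounded distance of O(P)^(KT) grid images (`exists_grid`),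
and noise around a signal is at most const^T times a wider Gaussian around a nearby grid image
(`map_add_pi_complexGaussian_le`). The constants depend on the channel but not on `P`, `F` or `T`.

Libraries that all `s` receivers decode correctly from one received word are determined by the
unrequested files and the cached pieces of the requested ones (`Code.card_decoded_le`). A cyclic
shift of distinct demands keeps these pieces within s²FμR bits (`exists_shift_sum_le`). Success
probability at least 1/2 thus forces 2^(FL)/2 ≤ const^T P^(KT) 2^(F(L-s) + s²FμR), that is, sF(1 -
sμR) - 1 ≤ T(K log₂ P + O(1)) (`Code.converse`). In the limit the delivery time is at least s(1 -
sμR)/K. The two bounds are K = N with s = 1, and K = N_T M with any `s`. -/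

namespace CacheMIMO

/-! ### Comparison of shifted Gaussian noise with wider noise -/

/-- A Gaussian of variance `1 / 2` and small mean is dominated by a wider centred Gaussian. -/
theorem gaussianReal_half_le {m ρ : ℝ} (hm : |m| ≤ ρ) :
    gaussianReal m (1 / 2) ≤ ENNReal.ofReal (√2 * Real.exp (ρ ^ 2)) • gaussianReal 0 1 := by
  rw [gaussianReal_of_var_ne_zero _ (by norm_num), gaussianReal_of_var_ne_zero _ one_ne_zero,
    ← withDensity_smul _ (measurable_gaussianPDF _ _)]
  refine withDensity_mono (Eventually.of_forall fun x => ?_)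
  simp only [Pi.smul_apply, smul_eq_mul, gaussianPDF]
  rw [← ENNReal.ofReal_mul (by positivity)]
  refine ENNReal.ofReal_le_ofReal ?_
  simp only [gaussianPDFReal, sub_zero]
  have h1 : (√(2 * Real.pi * ((1 / 2 : ℝ≥0) : ℝ)))⁻¹ = √2 * (√(2 * Real.pi * ((1 : ℝ≥0) : ℝ)))⁻¹ := by
    have h2 : √2 ≠ 0 := by positivity
    have h3 : √Real.pi ≠ 0 := by positivity
    have : (2 * Real.pi * ((1 / 2 : ℝ≥0) : ℝ)) = Real.pi := by push_cast; ring
    rw [this]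
    simp only [NNReal.coe_one, mul_one, Real.sqrt_mul (by norm_num : (0 : ℝ) ≤ 2)]
    field_simp
  rw [h1]
  have h4 : Real.exp (-(x - m) ^ 2 / (2 * ((1 / 2 : ℝ≥0) : ℝ))) ≤
      Real.exp (ρ ^ 2) * Real.exp (-x ^ 2 / (2 * ((1 : ℝ≥0) : ℝ))) := by
    rw [← Real.exp_add]
    refine Real.exp_le_exp.2 ?_
    -- The exponents compare because (x - m)² + m² - x²/2 = (x - 2m)²/2 ≥ 0.
    have hm2 : m ^ 2 ≤ ρ ^ 2 := sq_le_sq' (by linarith [neg_abs_le m]) (by linarith [le_abs_self m])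
    push_cast
    nlinarith [sq_nonneg (x / 2 - m), sq_nonneg (x - 2 * m)]
  calc _ ≤ √2 * (√(2 * Real.pi * ((1 : ℝ≥0) : ℝ)))⁻¹ *
        (Real.exp (ρ ^ 2) * Real.exp (-x ^ 2 / (2 * ((1 : ℝ≥0) : ℝ)))) := by gcongr
    _ = _ := by ring

/-- Circularly symmetric complex Gaussian law with mean zero and variance two. -/
noncomputable def wideGaussian : Measure ℂ :=
  ((gaussianReal 0 1).prod (gaussianReal 0 1)).map (fun p : ℝ × ℝ => (⟨p.1, p.2⟩ : ℂ))

theorem measurable_complex_mk : Measurable (fun p : ℝ × ℝ => (⟨p.1, p.2⟩ : ℂ)) :=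
  Complex.measurableEquivRealProd.symm.measurable

instance : IsProbabilityMeasure wideGaussian :=
  Measure.isProbabilityMeasure_map measurable_complex_mk.aemeasurable

instance : IsProbabilityMeasure complexGaussian :=
  Measure.isProbabilityMeasure_map measurable_complex_mk.aemeasurable

/-- Price per complex coordinate of comparing a shifted noise with a wide one. -/
noncomputable def shiftCost (ρ : ℝ) : ℝ := (√2 * Real.exp (ρ ^ 2)) ^ 2

theorem one_le_shiftCost (ρ : ℝ) : 1 ≤ shiftCost ρ := by
  refine one_le_pow₀ (one_le_mul_of_one_le_of_one_le ?_ ?_)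
  · rw [Real.one_le_sqrt]; norm_num
  · exact Real.one_le_exp (sq_nonneg ρ)

/-- Real and imaginary parts are independent, so the one-dimensional price is paid twice; hence the
square in `shiftCost`. -/
theorem map_add_complexGaussian_le {w : ℂ} {ρ : ℝ} (hr : |w.re| ≤ ρ) (hi : |w.im| ≤ ρ) :
    complexGaussian.map (w + ·) ≤ ENNReal.ofReal (shiftCost ρ) • wideGaussian := by
  have h : complexGaussian.map (w + ·) =
      ((gaussianReal w.re (1 / 2)).prod (gaussianReal w.im (1 / 2))).map
        (fun p : ℝ × ℝ => (⟨p.1, p.2⟩ : ℂ)) := by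
    have e : ∀ m : ℝ, gaussianReal m (1 / 2) = (gaussianReal 0 (1 / 2)).map (m + ·) := fun m => by
      rw [gaussianReal_map_const_add, zero_add]
    rw [complexGaussian, Measure.map_map (measurable_const_add w) measurable_complex_mk, e w.re,
      e w.im, Measure.map_prod_map _ _ (measurable_const_add _) (measurable_const_add _),
      Measure.map_map measurable_complex_mk
        ((measurable_const_add _).prodMap (measurable_const_add _))]
    congr 1
  rw [h, wideGaussian, ← Measure.map_smul]
  refine Measure.map_mono ?_ measurable_complex_mk
  have hc : ENNReal.ofReal (shiftCost ρ) = ENNReal.ofReal (√2 * Real.exp (ρ ^ 2)) *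
      ENNReal.ofReal (√2 * Real.exp (ρ ^ 2)) := by
    rw [← ENNReal.ofReal_mul (by positivity), shiftCost, sq]
  refine (Measure.prod_mono (gaussianReal_half_le hr) (gaussianReal_half_le hi)).trans ?_
  rw [Measure.prod_smul_left, Measure.prod_smul_right, smul_smul, hc]

/-- Coordinatewise domination passes to product measures. -/
theorem pi_le_smul_pi {ι : Type*} [Fintype ι] {α : ι → Type*} [∀ i, MeasurableSpace (α i)]
    {μ κ : ∀ i, Measure (α i)} [∀ i, SigmaFinite (μ i)] [∀ i, SigmaFinite (κ i)] {c : ℝ≥0∞}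
    (hc : c ≠ 0) (hc' : c ≠ ∞) (h : ∀ i, μ i ≤ c • κ i) :
    Measure.pi μ ≤ c ^ Fintype.card ι • Measure.pi κ := by
  classical
  set C : ℝ≥0∞ := c ^ Fintype.card ι with hC
  have hC0 : C ≠ 0 := pow_ne_zero _ hc
  have hCt : C ≠ ∞ := ENNReal.pow_ne_top hc'
  -- `OuterMeasure.pi` is the largest outer measure bounded by the product on boxes. With the
  -- constant moved to the left, checking boxes is enough.
  have key : (C⁻¹ • (Measure.pi μ).toOuterMeasure) ≤
      OuterMeasure.pi (fun i => (κ i).toOuterMeasure) := by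
    rw [OuterMeasure.le_pi]
    intro s _
    simp only [_root_.smul_apply, smul_eq_mul, Measure.coe_toOuterMeasure, Measure.pi_pi]
    calc C⁻¹ * ∏ i, μ i (s i) ≤ C⁻¹ * ∏ i, (c * κ i (s i)) := by
          gcongr with i
          exact h i _
      _ = ∏ i, κ i (s i) := by
          rw [Finset.prod_mul_distrib, Finset.prod_const, Finset.card_univ, ← hC, ← mul_assoc,
            ENNReal.inv_mul_cancel hC0 hCt, one_mul]
  refine Measure.le_iff.2 fun s hs => ?_
  have h1 := key s
  simp only [_root_.smul_apply, smul_eq_mul, Measure.coe_toOuterMeasure] at h1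
  have h2 : OuterMeasure.pi (fun i => (κ i).toOuterMeasure) s = Measure.pi κ s := by
    rw [Measure.pi, toMeasure_apply _ _ hs]
  rw [h2] at h1
  calc Measure.pi μ s = C * (C⁻¹ * Measure.pi μ s) := by
        rw [← mul_assoc, ENNReal.mul_inv_cancel hC0 hCt, one_mul]
    _ ≤ C * Measure.pi κ s := by gcongr
    _ = _ := rfl

/-- Noise around a signal is dominated by wide noise around a point that is near the signal. -/
theorem map_add_pi_complexGaussian_le {ι : Type*} [Fintype ι] {σ g : ι → ℂ} {ρ : ℝ}
    (hr : ∀ i, |(σ i - g i).re| ≤ ρ) (hi : ∀ i, |(σ i - g i).im| ≤ ρ) :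
    (Measure.pi (fun _ : ι => complexGaussian)).map (σ + ·) ≤
      ENNReal.ofReal (shiftCost ρ) ^ Fintype.card ι •
        (Measure.pi (fun _ : ι => wideGaussian)).map (g + ·) := by
  have hp : ∀ i, IsProbabilityMeasure (complexGaussian.map ((σ i - g i) + ·)) := fun i =>
    Measure.isProbabilityMeasure_map (measurable_const_add _).aemeasurable
  -- Translating by `g` last leaves only the small shift σ - g to be absorbed coordinatewise.
  have h1 : (Measure.pi (fun _ : ι => complexGaussian)).map (σ + ·) =
      (Measure.pi (fun i : ι => complexGaussian.map ((σ i - g i) + ·))).map (g + ·) := by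
    rw [← Measure.pi_map_pi (fun i => (measurable_const_add _).aemeasurable),
      Measure.map_map (measurable_const_add g) (by fun_prop)]
    congr 1
    funext z
    funext i
    simp only [Function.comp_apply, Pi.add_apply]
    ring
  rw [h1, ← Measure.map_smul]
  refine Measure.map_mono (pi_le_smul_pi ?_ ENNReal.ofReal_ne_top fun i =>
    map_add_complexGaussian_le (hr i) (hi i)) (measurable_const_add g)
  exact (ENNReal.ofReal_pos.2 (one_pos.trans_le (one_le_shiftCost ρ))).ne'

/-! ### Strong converse by covering the signal set -/

/-- If every point lies in at most `B` of the sets, then their measures add up to at most `B`. -/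
theorem sum_measure_le_of_card_le {α Ω : Type*} [Fintype Ω] [MeasurableSpace α] (Q : Measure α)
    [IsProbabilityMeasure Q] {E : Ω → Set α} (hE : ∀ w, MeasurableSet (E w)) {B : ℕ}
    (hB : ∀ y, Nat.card {w // y ∈ E w} ≤ B) : ∑ w, Q (E w) ≤ B := by
  classical
  calc ∑ w, Q (E w) = ∑ w, ∫⁻ y, (E w).indicator 1 y ∂Q := by
        simp only [lintegral_indicator_one (hE _)]
    _ = ∫⁻ y, ∑ w, (E w).indicator 1 y ∂Q :=
        (lintegral_finsetSum _ fun w _ => measurable_one.indicator (hE w)).symm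
    _ ≤ ∫⁻ _, (B : ℝ≥0∞) ∂Q := by
        refine lintegral_mono fun y => ?_
        have : ∑ w, (E w).indicator (1 : α → ℝ≥0∞) y = (Nat.card {w // y ∈ E w} : ℝ≥0∞) := by
          simp [Set.indicator_apply, Fintype.card_subtype]
        rw [this]
        exact Nat.cast_le.2 (hB y)
    _ = B := by simp

/-- Strong converse: with signals near a finite set `G` and decoding sets that cover no point more
than `B` times, the success probabilities of all messages add up to at most a multiple of
`#G * B`. -/
theorem sum_success_le {Ω ι : Type*} [Fintype Ω] [Fintype ι] {σ : Ω → ι → ℂ}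
    {E : Ω → Set (ι → ℂ)} (hE : ∀ w, MeasurableSet (E w)) {B : ℕ}
    (hB : ∀ y, Nat.card {w // y ∈ E w} ≤ B) {G : Finset (ι → ℂ)} {ρ : ℝ}
    (hG : ∀ w, ∃ g ∈ G, ∀ i, ‖σ w i - g i‖ ≤ ρ) :
    ∑ w, Measure.pi (fun _ : ι => complexGaussian) {z | σ w + z ∈ E w} ≤
      ENNReal.ofReal (shiftCost ρ) ^ Fintype.card ι * (G.card * B) := by
  set C := ENNReal.ofReal (shiftCost ρ) ^ Fintype.card ι
  set Q := Measure.pi (fun _ : ι => wideGaussian)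
  have hQ : ∀ g : ι → ℂ, IsProbabilityMeasure (Q.map (g + ·)) := fun g =>
    Measure.isProbabilityMeasure_map (measurable_const_add g).aemeasurable
  -- The nearby point depends on `w`; summing over all of `G` removes this dependence, so that the
  -- two sums can be exchanged.
  have h1 : ∀ w, Measure.pi (fun _ : ι => complexGaussian) {z | σ w + z ∈ E w} ≤
      C * ∑ g ∈ G, Q.map (g + ·) (E w) := fun w => by
    obtain ⟨g, hg, h⟩ := hG w
    have h2 := map_add_pi_complexGaussian_le (σ := σ w) (g := g) (ρ := ρ)
      (fun i => (Complex.abs_re_le_norm _).trans (h i))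
      (fun i => (Complex.abs_im_le_norm _).trans (h i)) (E w)
    rw [Measure.map_apply (measurable_const_add (σ w)) (hE w)] at h2
    refine h2.trans ?_
    rw [Measure.smul_apply, smul_eq_mul]
    gcongr
    exact Finset.single_le_sum (f := fun g => Q.map (g + ·) (E w)) (fun _ _ => zero_le) hg
  calc _ ≤ ∑ w, C * ∑ g ∈ G, Q.map (g + ·) (E w) := Finset.sum_le_sum fun w _ => h1 w
    _ = C * ∑ g ∈ G, ∑ w, Q.map (g + ·) (E w) := by rw [← Finset.mul_sum, Finset.sum_comm]
    _ ≤ C * ∑ g ∈ G, (B : ℝ≥0∞) := by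
        gcongr with g
        exact sum_measure_le_of_card_le _ hE hB
    _ = _ := by simp

/-- A finite grid of mesh one in the box of radius `x`. -/
theorem exists_grid (κ : Type*) [Fintype κ] {x : ℝ} (hx : 1 ≤ x) :
    ∃ G : Finset (κ → ℂ), (G.card : ℝ) ≤ (25 * x ^ 2) ^ Fintype.card κ ∧
      ∀ u : κ → ℂ, (∀ k, ‖u k‖ ≤ x) → ∃ g ∈ G, ∀ k, ‖u k - g k‖ ≤ 2 := by
  classical
  set R : ℤ := (⌈x⌉₊ : ℤ) with hR
  have hRx : x ≤ R := by rw [hR]; exact_mod_cast Nat.le_ceil x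
  have hRx' : (R : ℝ) ≤ x + 1 := by
    rw [hR]; exact_mod_cast (Nat.ceil_lt_add_one (by linarith)).le
  set box : Finset ℂ := (Finset.Icc (-R) R ×ˢ Finset.Icc (-R) R).image
    (fun p : ℤ × ℤ => (⟨p.1, p.2⟩ : ℂ)) with hbox
  have hcard : (box.card : ℝ) ≤ 25 * x ^ 2 := by
    have h1 : box.card ≤ (R + 1 - -R).toNat * (R + 1 - -R).toNat := by
      refine Finset.card_image_le.trans ?_
      rw [Finset.card_product, Int.card_Icc]
    -- A side has 2R + 1 ≤ 2x + 3 ≤ 5x points, as x ≥ 1; a complex coordinate needs the square,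
    -- 25x².
    have h2 : (((R + 1 - -R).toNat : ℕ) : ℝ) ≤ 5 * x := by
      have : (((R + 1 - -R).toNat : ℕ) : ℤ) = R + 1 - -R := Int.toNat_of_nonneg (by omega)
      have h3 : (((R + 1 - -R).toNat : ℕ) : ℝ) = R + 1 - -R := by exact_mod_cast this
      rw [h3]; linarith
    calc (box.card : ℝ) ≤ ((R + 1 - -R).toNat : ℝ) * ((R + 1 - -R).toNat : ℝ) := by
          exact_mod_cast h1
      _ ≤ (5 * x) * (5 * x) := by gcongr
      _ = _ := by ring
  refine ⟨Fintype.piFinset fun _ => box, ?_, fun u hu => ?_⟩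
  · rw [Fintype.card_piFinset]
    simp only [Finset.prod_const, Finset.card_univ, Nat.cast_pow]
    gcongr
  · refine ⟨fun k => ⟨⌊(u k).re⌋, ⌊(u k).im⌋⟩, ?_, fun k => ?_⟩
    · have hf : ∀ a : ℝ, |a| ≤ x → ⌊a⌋ ∈ Finset.Icc (-R) R := fun a ha => by
        rw [abs_le] at ha
        rw [Finset.mem_Icc]
        constructor
        · rw [Int.le_floor]; push_cast; linarith
        · have : (⌊a⌋ : ℝ) ≤ R := (Int.floor_le a).trans (by linarith)
          exact_mod_cast this
      rw [Fintype.mem_piFinset]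
      intro k
      rw [hbox, Finset.mem_image]
      exact ⟨(⌊(u k).re⌋, ⌊(u k).im⌋), Finset.mem_product.2
        ⟨hf _ ((Complex.abs_re_le_norm _).trans (hu k)),
          hf _ ((Complex.abs_im_le_norm _).trans (hu k))⟩, rfl⟩
    · refine (Complex.norm_le_abs_re_add_abs_im _).trans ?_
      have hf : ∀ a : ℝ, |a - ⌊a⌋| ≤ 1 := fun a => by
        rw [abs_le]
        constructor <;> linarith [Int.floor_le a, Int.lt_floor_add_one a]
      have h1 := hf (u k).re
      have h2 := hf (u k).im
      simp only [Complex.sub_re, Complex.sub_im]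
      linarith

/-! ### Counting the libraries that a code can deliver -/

namespace Code

variable {NT NR M N L F : ℕ} {μR μT : ℝ} {P : ℝ≥0}

/-- Noiseless part of the received signal. -/
def signal (C : Code NT NR M N L μR μT P F) (d : Demand NR L) (H : Channel NT NR M N)
    (W : Library L F) (p : Fin NR × Fin N × Fin (C.T d H)) : ℂ :=
  ∑ i, ∑ m, H (p.1, i, p.2.1, m) * C.enc i (C.txCache i W) d H p.2.2 m

/-- The total error of some receivers bounds the probability that one of them errs. -/
theorem card_le_sum_success_add (C : Code NT NR M N L μR μT P F) (H : Channel NT NR M N)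
    (d : Demand NR L) (A : Finset (Fin NR)) :
    (Fintype.card (Library L F) : ℝ≥0∞) ≤
      ∑ W, noiseLaw NR N (C.T d H) {z | ∀ j ∈ A, C.estimate d H j W z = W (d j)} +
        Fintype.card (Library L F) * ∑ j ∈ A, C.errorProb H d j := by
  classical
  have hprob : IsProbabilityMeasure (noiseLaw NR N (C.T d H)) := by
    unfold noiseLaw; infer_instance
  have hmeas : ∀ j W, Measurable (fun z => C.estimate d H j W z) := fun j W => by
    refine (C.dec_measurable j _ d H).comp ?_
    unfold received
    fun_prop
  have herr : ∀ j, (Fintype.card (Library L F) : ℝ≥0∞) * C.errorProb H d j =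
      ∑ W, noiseLaw NR N (C.T d H) {z | C.estimate d H j W z ≠ W (d j)} := fun j => by
    have hm : MeasurableSet {p : Library L F × (Fin NR × Fin N × Fin (C.T d H) → ℂ) |
        C.estimate d H j p.1 p.2 ≠ p.1 (d j)} := by
      have h1 : Measurable (fun p : Library L F × (Fin NR × Fin N × Fin (C.T d H) → ℂ) =>
          C.estimate d H j p.1 p.2) := measurable_from_prod_countable_right (hmeas j)
      have h2 : Measurable (fun p : Library L F × (Fin NR × Fin N × Fin (C.T d H) → ℂ) =>
          p.1 (d j)) := by fun_prop
      exact (measurableSet_eq_fun h1 h2).compl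
    rw [errorProb, Measure.prod_apply hm, libraryLaw, uniformOn, ProbabilityTheory.cond, Measure.restrict_univ,
      lintegral_smul_measure, lintegral_count, tsum_fintype, smul_eq_mul, ← mul_assoc,
      Measure.count_univ, ENat.card_eq_coe_fintype_card]
    have h0 : (Fintype.card (Library L F) : ℝ≥0∞) ≠ 0 := by
      simp
    rw [ENat.toENNReal_coe, ENNReal.mul_inv_cancel h0 (ENNReal.natCast_ne_top _), one_mul]
    rfl
  rw [Finset.mul_sum]
  simp only [herr]
  rw [Finset.sum_comm, ← Finset.sum_add_distrib]
  have h1 : (Fintype.card (Library L F) : ℝ≥0∞) = ∑ _W : Library L F, 1 := by simp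
  rw [h1]
  refine Finset.sum_le_sum fun W _ => ?_
  rw [← measure_univ (μ := noiseLaw NR N (C.T d H))]
  refine (measure_mono (t := {z | ∀ j ∈ A, C.estimate d H j W z = W (d j)} ∪
    ⋃ j ∈ A, {z | C.estimate d H j W z ≠ W (d j)}) fun z _ => ?_).trans
    ((measure_union_le _ _).trans (add_le_add le_rfl (measure_biUnion_finset_le _ _)))
  by_cases h : ∀ j ∈ A, C.estimate d H j W z = W (d j)
  · exact Or.inl h
  · push Not at h
    obtain ⟨j, hj, hjz⟩ := h
    exact Or.inr (Set.mem_biUnion hj hjz)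

/-- Number of libraries that a given received signal can be decoded to. -/
theorem card_decoded_le (C : Code NT NR M N L μR μT P F) (H : Channel NT NR M N)
    (d : Demand NR L) (A : Finset (Fin NR)) {k : Fin NR → Fin L → ℕ}
    {c : ∀ j l, Fin (2 ^ F) → Fin (k j l)}
    {e : ∀ j, (∀ l, Fin (k j l)) → Fin (2 ^ cacheBits μR L F)}
    (hc : ∀ j W, C.rxCache j W = e j fun l => c j l (W l))
    (y : Fin NR × Fin N × Fin (C.T d H) → ℂ) :
    Nat.card {W : Library L F // ∀ j ∈ A,
        C.dec j (C.rxCache j W) d H (fun n t => y (j, n, t)) = W (d j)} ≤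
      (2 ^ F) ^ (L - (A.image d).card) * ∏ j ∈ A, ∏ l ∈ A.image d, k j l := by
  classical
  set S := A.image d with hS
  -- The data kept are the unrequested files and the cached pieces of the requested ones. They fix
  -- the caches of the receivers in `A`, hence the decoder outputs on `y`, hence the requested
  -- files. The absence of coding across files enters here.
  let f : {W : Library L F // ∀ j ∈ A,
      C.dec j (C.rxCache j W) d H (fun n t => y (j, n, t)) = W (d j)} →
      ({l // l ∉ S} → Fin (2 ^ F)) × (∀ (j : A) (l : S), Fin (k j l)) :=
    fun W => (fun l => W.1 l, fun j l => c j l (W.1 l))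
  have hf : Function.Injective f := by
    rintro ⟨W, hW⟩ ⟨W', hW'⟩ h
    obtain ⟨h1, h2⟩ := Prod.ext_iff.1 h
    have hout : ∀ l, l ∉ S → W l = W' l := fun l hl => congrFun h1 ⟨l, hl⟩
    have hin : ∀ j ∈ A, ∀ l ∈ S, c j l (W l) = c j l (W' l) := fun j hj l hl =>
      congrFun (congrFun h2 ⟨j, hj⟩) ⟨l, hl⟩
    refine Subtype.ext (funext fun l => ?_)
    by_cases hl : l ∈ S
    · obtain ⟨j, hj, rfl⟩ := Finset.mem_image.1 hl
      change W (d j) = W' (d j)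
      have hcache : C.rxCache j W = C.rxCache j W' := by
        rw [hc, hc]
        congr 1
        funext l'
        by_cases hl' : l' ∈ S
        · exact hin j hj l' hl'
        · rw [hout l' hl']
      rw [← hW j hj, ← hW' j hj, hcache]
    · exact hout l hl
  refine (Nat.card_le_card_of_injective f hf).trans (le_of_eq ?_)
  rw [Nat.card_prod, Nat.card_eq_fintype_card, Nat.card_eq_fintype_card]
  congr 1
  · simp [Fintype.card_subtype_compl]
  · simp only [Fintype.card_pi, Fintype.card_fin]
    rw [← Finset.prod_coe_sort A]
    refine Finset.prod_congr rfl fun j _ => ?_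
    rw [← Finset.prod_coe_sort S]

/-- Counting form of the converse, for signals of the receivers in `A` that are linear images of
vectors `u` whose entries have modulus at most `x`. -/
theorem half_card_le (C : Code NT NR M N L μR μT P F) (H : Channel NT NR M N)
    (d : Demand NR L) (A : Finset (Fin NR)) {k : Fin NR → Fin L → ℕ}
    {c : ∀ j l, Fin (2 ^ F) → Fin (k j l)}
    {e : ∀ j, (∀ l, Fin (k j l)) → Fin (2 ^ cacheBits μR L F)}
    (hc : ∀ j W, C.rxCache j W = e j fun l => c j l (W l))
    (herr : ∑ j ∈ A, C.errorProb H d j ≤ 1 / 2)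
    {κ : Type*} [Fintype κ] (a : κ → Fin NR × Fin N → ℂ)
    {u : Library L F → Fin (C.T d H) × κ → ℂ} {x : ℝ} (hx : 1 ≤ x) (hu : ∀ W p, ‖u W p‖ ≤ x)
    (hsig : ∀ W, ∀ j ∈ A, ∀ n t, C.signal d H W (j, n, t) = ∑ q, a q (j, n) * u W (t, q)) :
    ((2 : ℝ) ^ F) ^ L / 2 ≤ shiftCost (2 * ∑ q, ∑ p, ‖a q p‖) ^ (NR * (N * C.T d H)) *
      ((25 * x ^ 2) ^ (C.T d H * Fintype.card κ) *
        ((2 ^ F) ^ (L - (A.image d).card) * ∏ j ∈ A, ∏ l ∈ A.image d, (k j l : ℝ))) := by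
  classical
  obtain ⟨G, hG, hGu⟩ := exists_grid (Fin (C.T d H) × κ) hx
  -- The grid error 2, amplified by the linear map `a`. It depends on neither `P` nor the block
  -- length, so the noise comparison costs O(1) bits per slot.
  set ρ := 2 * ∑ q, ∑ p, ‖a q p‖
  -- This image is known to equal the signal only at receivers in `A`, the only ones the decoding
  -- sets `E W` inspect.
  set img : (Fin (C.T d H) × κ → ℂ) → Fin NR × Fin N × Fin (C.T d H) → ℂ :=
    fun v p => ∑ q, a q (p.1, p.2.1) * v (p.2.2, q) with himg
  set E : Library L F → Set (Fin NR × Fin N × Fin (C.T d H) → ℂ) := fun W =>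
    {y | ∀ j ∈ A, C.dec j (C.rxCache j W) d H (fun n t => y (j, n, t)) = W (d j)} with hEdef
  have hE : ∀ W, MeasurableSet (E W) := fun W => by
    have : E W = ⋂ j ∈ A, {y | C.dec j (C.rxCache j W) d H (fun n t => y (j, n, t)) = W (d j)} := by
      ext y; simp [hEdef]
    rw [this]
    refine Finset.measurableSet_biInter _ fun j _ => ?_
    have hm : Measurable fun y : Fin NR × Fin N × Fin (C.T d H) → ℂ =>
        C.dec j (C.rxCache j W) d H (fun n t => y (j, n, t)) :=
      (C.dec_measurable j _ d H).comp (by fun_prop)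
    exact hm (measurableSet_singleton _)
  have hset : ∀ W, {z | ∀ j ∈ A, C.estimate d H j W z = W (d j)} =
      {z | img (u W) + z ∈ E W} := fun W => by
    ext z
    refine forall₂_congr fun j hj => ?_
    have : C.received d H W z j = fun n t => (img (u W) + z) (j, n, t) := by
      funext n t
      have := hsig W j hj n t
      simp only [signal] at this
      simp [received, himg, this]
    rw [estimate, this]
  have hnear : ∀ W, ∃ g ∈ G.image img, ∀ i, ‖img (u W) i - g i‖ ≤ ρ := fun W => by
    obtain ⟨g, hg, h⟩ := hGu (u W) (hu W)
    refine ⟨img g, Finset.mem_image_of_mem _ hg, fun i => ?_⟩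
    simp only [himg, ← Finset.sum_sub_distrib, ← mul_sub]
    refine (norm_sum_le _ _).trans ?_
    change _ ≤ 2 * ∑ q, ∑ p, ‖a q p‖
    rw [Finset.mul_sum]
    refine Finset.sum_le_sum fun q _ => ?_
    rw [norm_mul, mul_comm]
    gcongr
    · exact h _
    · exact Finset.single_le_sum (f := fun p => ‖a q p‖) (fun _ _ => norm_nonneg _)
        (Finset.mem_univ _)
  have h1 := sum_success_le hE (C.card_decoded_le H d A hc) hnear
  have h2 := C.card_le_sum_success_add H d A
  simp only [hset] at h2
  set n : ℝ≥0∞ := (Fintype.card (Library L F) : ℝ≥0∞) with hn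
  set B : ℕ := (2 ^ F) ^ (L - (A.image d).card) * ∏ j ∈ A, ∏ l ∈ A.image d, k j l with hB
  have hι : Fintype.card (Fin NR × Fin N × Fin (C.T d H)) = NR * (N * C.T d H) := by simp
  rw [hι] at h1
  have h3 : n ≤ ENNReal.ofReal (shiftCost ρ) ^ (NR * (N * C.T d H)) *
      (((G.image img).card : ℝ≥0∞) * B) + n * (1 / 2) :=
    h2.trans (add_le_add h1 (by gcongr))
  have hs0 : 0 ≤ shiftCost ρ := zero_le_one.trans (one_le_shiftCost ρ)
  have h4 : (Fintype.card (Library L F) : ℝ) ≤ shiftCost ρ ^ (NR * (N * C.T d H)) *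
      (((G.image img).card : ℝ) * B) + Fintype.card (Library L F) * (1 / 2) := by
    have := ENNReal.toReal_mono (by finiteness) h3
    rw [ENNReal.toReal_add (by finiteness) (by finiteness)] at this
    simpa [hn, ENNReal.toReal_ofReal hs0] using this
  have hcard : (Fintype.card (Library L F) : ℝ) = ((2 : ℝ) ^ F) ^ L := by simp
  have hBr : (B : ℝ) = (2 ^ F) ^ (L - (A.image d).card) * ∏ j ∈ A, ∏ l ∈ A.image d, (k j l : ℝ) := by
    rw [hB]; push_cast; rfl
  rw [hcard] at h4
  rw [← hBr]
  have h5 : ((G.image img).card : ℝ) ≤ (25 * x ^ 2) ^ (C.T d H * Fintype.card κ) := by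
    refine (Nat.cast_le.2 Finset.card_image_le).trans (hG.trans_eq ?_)
    simp
  calc ((2 : ℝ) ^ F) ^ L / 2 ≤ shiftCost ρ ^ (NR * (N * C.T d H)) *
        (((G.image img).card : ℝ) * B) := by linarith
    _ ≤ _ := by gcongr

end Code

/-! ### Choice of demands and the bound on the block length -/

/-- Some cyclic shift of a set of indices has at most the average weight. -/
theorem exists_shift_sum_le {L : ℕ} [NeZero L] (I : Finset (Fin L)) (a : Fin L → ℝ) :
    ∃ r, (L : ℝ) * ∑ i ∈ I, a (i + r) ≤ I.card * ∑ l, a l := by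
  by_contra! h
  have h1 : ∑ r : Fin L, (L : ℝ) * ∑ i ∈ I, a (i + r) = L * (I.card * ∑ l, a l) := by
    rw [← Finset.mul_sum, Finset.sum_comm]
    have : ∀ i, ∑ r, a (i + r) = ∑ l, a l := fun i => Equiv.sum_comp (Equiv.addLeft i) a
    simp [this]
  have h2 : ∑ _r : Fin L, (I.card * ∑ l, a l) < ∑ r : Fin L, (L : ℝ) * ∑ i ∈ I, a (i + r) :=
    Finset.sum_lt_sum_of_nonempty ⟨0, Finset.mem_univ _⟩ fun r _ => h r
  rw [h1] at h2
  simp at h2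

/-- The alphabets of an injective labelling have sizes that multiply to at most the number of
labels. -/
theorem sum_logb_card_le {L b : ℕ} {k : Fin L → ℕ} (hk : ∀ l, 0 < k l)
    {e : (∀ l, Fin (k l)) → Fin (2 ^ b)} (he : Function.Injective e) :
    ∑ l, Real.logb 2 (k l) ≤ b := by
  have h1 : ∏ l, k l ≤ 2 ^ b := by simpa using Fintype.card_le_of_injective e he
  have h2 : ((∏ l, k l : ℕ) : ℝ) ≤ 2 ^ b := by exact_mod_cast h1
  rw [← Real.logb_prod _ _ fun l _ => by exact_mod_cast (hk l).ne']
  rw [← Nat.cast_prod, Real.logb_le_iff_le_rpow one_lt_two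
    (by exact_mod_cast Finset.prod_pos fun l _ => hk l), Real.rpow_natCast]
  exact h2

namespace Code

variable {NT NR M N L F : ℕ} {μR μT : ℝ} {P : ℝ≥0}

/-- Block length for `s` active receivers whose noiseless signals are, for every demand, linear
images of vectors indexed by `κ` with entries of modulus at most `c √P`. -/
theorem converse (C : Code NT NR M N L μR μT P F) (H : Channel NT NR M N) (hL : NR ≤ L)
    (hμR : 0 ≤ μR) {s : ℕ} (hs : 1 ≤ s) (hsNR : s ≤ NR) (hP : 1 ≤ P)
    (herr : C.worstErrorProb H ≤ ((2 * NR : ℕ) : ℝ≥0∞)⁻¹)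
    {κ : Type*} [Fintype κ] (a : κ → Fin NR × Fin N → ℂ) {c : ℝ} (hc : 1 ≤ c)
    (hsig : ∀ d : Demand NR L, ∃ u : Library L F → Fin (C.T d H) × κ → ℂ,
      (∀ W p, ‖u W p‖ ≤ c * √P) ∧ ∀ W (j : Fin NR), j.val < s → ∀ n t,
        C.signal d H W (j, n, t) = ∑ q, a q (j, n) * u W (t, q)) :
    s * F * (1 - s * μR) - 1 ≤ C.maxT H *
      (NR * N * Real.logb 2 (shiftCost (2 * ∑ q, ∑ p, ‖a q p‖)) +
        Fintype.card κ * Real.logb 2 (25 * c ^ 2) + Fintype.card κ * Real.logb 2 P) := by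
  classical
  have hL0 : 0 < L := by omega
  have hLr : (0 : ℝ) < L := by exact_mod_cast hL0
  have : NeZero L := ⟨hL0.ne'⟩
  choose k g e he hk using C.rxCache_intra
  have hk0 : ∀ j l, 0 < k j l := fun j l =>
    Fin.pos (g j l ⟨0, by positivity⟩)
  have hlog0 : ∀ j l, 0 ≤ Real.logb 2 (k j l) := fun j l =>
    Real.logb_nonneg one_lt_two (by exact_mod_cast hk0 j l)
  set A : Finset (Fin NR) := Finset.univ.filter fun j => j.val < s with hA
  have hAcard : A.card = s := by
    have : A = (Finset.univ : Finset (Fin s)).map (Fin.castLEEmb hsNR) := by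
      ext j
      simp only [hA, Finset.mem_filter, Finset.mem_univ, true_and, Finset.mem_map]
      exact ⟨fun h => ⟨⟨j, h⟩, rfl⟩, by rintro ⟨i, rfl⟩; exact i.2⟩
    rw [this, Finset.card_map, Finset.card_fin]
  -- The weight of a file is the number of bits that the caches of the active receivers devote to
  -- it. A shift of at most average weight gives distinct demands whose cached share is at most
  -- s²FμR bits.
  obtain ⟨r, hr⟩ := exists_shift_sum_le (A.map (Fin.castLEEmb hL))
    (fun l => ∑ j ∈ A, Real.logb 2 (k j l))
  set d : Demand NR L := fun j => Fin.castLE hL j + r with hd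
  have hdinj : Function.Injective d := fun i j hij =>
    Fin.castLE_injective hL (add_right_cancel hij)
  have hcache : ∑ j ∈ A, ∑ l ∈ A.image d, Real.logb 2 (k j l) ≤ s * (s * (F * μR)) := by
    rw [Finset.sum_comm, Finset.sum_image hdinj.injOn]
    have h1 : ∑ l, ∑ j ∈ A, Real.logb 2 (k j l) ≤ s * (F * (μR * L)) := by
      rw [Finset.sum_comm]
      have : ∀ j ∈ A, ∑ l, Real.logb 2 (k j l) ≤ F * (μR * L) := fun j _ =>
        (sum_logb_card_le (hk0 j) (he j)).trans (Nat.floor_le (by positivity))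
      simpa [hAcard] using Finset.sum_le_card_nsmul _ _ _ this
    rw [Finset.sum_map, Finset.card_map, hAcard] at hr
    refine le_of_mul_le_mul_left (hr.trans ?_) hLr
    calc (s : ℝ) * ∑ l, ∑ j ∈ A, Real.logb 2 (k j l) ≤ s * (s * (F * (μR * L))) := by gcongr
      _ = _ := by ring
  -- The error threshold 1/(2 NR) is chosen for this union bound; the lost factor 2 becomes the `-
  -- 1` of the conclusion.
  have hsum : ∑ j ∈ A, C.errorProb H d j ≤ 1 / 2 := by
    have h1 : ∀ j ∈ A, C.errorProb H d j ≤ ((2 * NR : ℕ) : ℝ≥0∞)⁻¹ := fun j _ =>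
      (le_iSup₂ (f := fun (d : Demand NR L) (j : Fin NR) => C.errorProb H d j) d j).trans herr
    refine (Finset.sum_le_card_nsmul _ _ _ h1).trans ?_
    have hNR : (NR : ℝ≥0∞) ≠ 0 := by
      exact_mod_cast (show NR ≠ 0 by omega)
    rw [hAcard, nsmul_eq_mul]
    calc (s : ℝ≥0∞) * ((2 * NR : ℕ) : ℝ≥0∞)⁻¹ ≤ NR * ((2 * NR : ℕ) : ℝ≥0∞)⁻¹ := by gcongr
      _ = 1 / 2 := by
        rw [Nat.cast_mul, ENNReal.mul_inv (Or.inr (ENNReal.natCast_ne_top _)) (Or.inr hNR),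
          mul_comm, mul_assoc, ENNReal.inv_mul_cancel hNR (ENNReal.natCast_ne_top _)]
        simp
  obtain ⟨u, hu, hsu⟩ := hsig d
  have hP' : (1 : ℝ) ≤ P := by exact_mod_cast hP
  have hx : 1 ≤ c * √P := one_le_mul_of_one_le_of_one_le hc (Real.one_le_sqrt.2 hP')
  have key := C.half_card_le H d A hk hsum a hx hu fun W j hj =>
    hsu W j (Finset.mem_filter.1 hj).2
  rw [Finset.card_image_of_injective _ hdinj, hAcard] at key
  set D := shiftCost (2 * ∑ q, ∑ p, ‖a q p‖)
  have hD : 1 ≤ D := one_le_shiftCost _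
  have hD0 : 0 < D := one_pos.trans_le hD
  have hx0 : 0 < c * √P := one_pos.trans_le hx
  have hprod : ∏ j ∈ A, ∏ l ∈ A.image d, (k j l : ℝ) ≠ 0 :=
    Finset.prod_ne_zero_iff.2 fun j _ => Finset.prod_ne_zero_iff.2 fun l _ => by
      exact_mod_cast (hk0 j l).ne'
  have hl := Real.logb_le_logb_of_le one_lt_two (by positivity) key
  -- Each complex coordinate of a slot contributes exactly one log₂ P, since the grid size is
  -- quadratic in √P.
  have h25 : Real.logb 2 (25 * (c * √P) ^ 2) = Real.logb 2 (25 * c ^ 2) + Real.logb 2 P := by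
    rw [mul_pow, Real.sq_sqrt (by positivity), ← mul_assoc,
      Real.logb_mul (by positivity) (by positivity)]
  have h2 : Real.logb 2 2 = 1 := Real.logb_self_eq_one one_lt_two
  have hprodlog : Real.logb 2 (∏ j ∈ A, ∏ l ∈ A.image d, (k j l : ℝ)) =
      ∑ j ∈ A, ∑ l ∈ A.image d, Real.logb 2 (k j l) := by
    rw [Real.logb_prod _ _ fun j _ => Finset.prod_ne_zero_iff.2 fun l _ => by
      exact_mod_cast (hk0 j l).ne']
    exact Finset.sum_congr rfl fun j _ => Real.logb_prod _ _ fun l _ => by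
      exact_mod_cast (hk0 j l).ne'
  rw [Real.logb_div (by positivity) (by norm_num), Real.logb_mul (by positivity) (by positivity),
    Real.logb_mul (by positivity) (by positivity), Real.logb_mul (by positivity) hprod, hprodlog,
    Real.logb_pow, Real.logb_pow, Real.logb_pow, Real.logb_pow, Real.logb_pow, Real.logb_pow,
    h25, h2, Nat.cast_sub (hsNR.trans hL)] at hl
  have hT : (C.T d H : ℝ) ≤ C.maxT H := by
    exact_mod_cast Finset.le_sup (f := fun d => C.T d H) (Finset.mem_univ d)
  have hnn : 0 ≤ NR * N * Real.logb 2 D +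
        Fintype.card κ * Real.logb 2 (25 * c ^ 2) + Fintype.card κ * Real.logb 2 P := by
    have h1 := Real.logb_nonneg one_lt_two hD
    have h3 := Real.logb_nonneg one_lt_two (x := 25 * c ^ 2) (by nlinarith)
    have h4 := Real.logb_nonneg one_lt_two hP'
    positivity
  refine le_trans ?_ (mul_le_mul_of_nonneg_right hT hnn)
  push_cast at hl
  linarith

end Code

/-! ### Passage to the normalized delivery time -/

/-- A lower bound of the block lengths passes to the normalized delivery time. -/
theorem Scheme.HasNDT.le_of_converse {NT NR M N L : ℕ} {μR μT : ℝ} {S : Scheme NT NR M N L μR μT}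
    {H : Channel NT NR M N} {l : EReal} (hl : S.HasNDT H l) {β c₀ r : ℝ} (hr : 0 < r)
    (h : ∀ᶠ P : ℝ≥0 in atTop, ∀ᶠ F : ℕ in atTop,
      β * F - 1 ≤ (S P F).maxT H * (c₀ + r * Real.logb 2 P)) :
    ((β / r : ℝ) : EReal) ≤ l := by
  have hlog : Tendsto (fun P : ℝ≥0 => Real.logb 2 (P : ℝ)) atTop atTop :=
    (Real.tendsto_logb_atTop one_lt_two).comp (NNReal.tendsto_coe_atTop.2 tendsto_id)
  -- The bounded cost `c₀` per slot vanishes relative to log₂ P; only the slope `r` survives.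
  have hlim : Tendsto (fun P : ℝ≥0 => β * (Real.logb 2 P / (c₀ + r * Real.logb 2 P))) atTop
      (𝓝 (β / r)) := by
    have h1 : Tendsto (fun y : ℝ => β * (y / (c₀ + r * y))) atTop (𝓝 (β / r)) := by
      have h2 : Tendsto (fun y : ℝ => β * (c₀ * y⁻¹ + r)⁻¹) atTop (𝓝 (β * (c₀ * 0 + r)⁻¹)) :=
        (((tendsto_inv_atTop_zero.const_mul c₀).add_const r).inv₀ (by simpa using hr.ne')).const_mul β
      have h3 : β * (c₀ * 0 + r)⁻¹ = β / r := by rw [mul_zero, zero_add, div_eq_mul_inv]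
      rw [h3] at h2
      refine h2.congr' ?_
      filter_upwards [eventually_gt_atTop 0] with y hy
      rw [show c₀ + r * y = (c₀ * y⁻¹ + r) * y by field_simp, div_mul_cancel_right₀ hy.ne']
    exact h1.comp hlog
  refine le_of_tendsto_of_tendsto ((continuous_coe_real_ereal.tendsto _).comp hlim) hl ?_
  filter_upwards [h, hlog.eventually_gt_atTop 0,
    (tendsto_atTop_add_const_left _ c₀ (hlog.const_mul_atTop hr)).eventually_gt_atTop 0]
    with P hP hP0 hPc
  set y := Real.logb 2 (P : ℝ)
  -- At fixed power the `- 1` turns into 1/F and disappears. Comparing with a convergent sequence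
  -- bounds the upper limit from below.
  have h1 : Tendsto (fun F : ℕ => (((β - 1 / (F : ℝ)) * (y / (c₀ + r * y)) : ℝ) : EReal)) atTop
      (𝓝 ((β * (y / (c₀ + r * y)) : ℝ) : EReal)) := by
    refine (continuous_coe_real_ereal.tendsto _).comp ?_
    have := (tendsto_one_div_atTop_nhds_zero_nat (𝕜 := ℝ)).const_sub β
    simpa using this.mul_const (y / (c₀ + r * y))
  change _ ≤ limsup (fun F : ℕ => S.relTime H P F) atTop
  simp only [Function.comp_apply]
  rw [← h1.limsup_eq]
  refine limsup_le_limsup ?_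
  filter_upwards [hP, eventually_ge_atTop 1] with F hF hF1
  have hF0 : (0 : ℝ) < F := by exact_mod_cast hF1
  refine EReal.coe_le_coe_iff.2 ?_
  rw [div_div_eq_mul_div, mul_div_assoc', div_le_div_iff₀ hPc hF0]
  have e : (β - 1 / (F : ℝ)) * y * F = (β * F - 1) * y := by field_simp
  rw [e]
  nlinarith [mul_le_mul_of_nonneg_right hF hP0.le]

theorem Code.norm_enc_le {NT NR M N L F : ℕ} {μR μT : ℝ} {P : ℝ≥0}
    (C : Code NT NR M N L μR μT P F) (i : Fin NT) (u : Fin (2 ^ cacheBits μT L F))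
    (d : Demand NR L) (H : Channel NT NR M N) (t : Fin (C.T d H)) (m : Fin M) :
    ‖C.enc i u d H t m‖ ≤ √P :=
  Real.le_sqrt_of_sq_le ((Finset.single_le_sum (f := fun m => ‖C.enc i u d H t m‖ ^ 2)
    (fun _ _ => sq_nonneg _) (Finset.mem_univ m)).trans (C.enc_power i u d H t))

/-- Provides the amplitude constant for `receive_bound`: the sum of all gains serves every receiver,
antenna and slot at once, and the added 1 makes the constant at least 1. -/
theorem Code.norm_signal_le {NT NR M N L F : ℕ} {μR μT : ℝ} {P : ℝ≥0}
    (C : Code NT NR M N L μR μT P F) (d : Demand NR L) (H : Channel NT NR M N)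
    (W : Library L F) (p : Fin NR × Fin N × Fin (C.T d H)) :
    ‖C.signal d H W p‖ ≤ (1 + ∑ i, ∑ m, ∑ j, ∑ n, ‖H (j, i, n, m)‖) * √P := by
  have h1 : ‖C.signal d H W p‖ ≤ ∑ i, ∑ m, (∑ j, ∑ n, ‖H (j, i, n, m)‖) * √P := by
    refine (norm_sum_le _ _).trans (Finset.sum_le_sum fun i _ => ?_)
    refine (norm_sum_le _ _).trans (Finset.sum_le_sum fun m _ => ?_)
    rw [norm_mul]
    refine mul_le_mul ?_ (C.norm_enc_le _ _ _ _ _ _) (norm_nonneg _) (by positivity)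
    exact (Finset.single_le_sum (f := fun n => ‖H (p.1, i, n, m)‖) (fun _ _ => norm_nonneg _)
      (Finset.mem_univ p.2.1)).trans
      (Finset.single_le_sum (f := fun j => ∑ n, ‖H (j, i, n, m)‖) (fun _ _ => by positivity)
      (Finset.mem_univ p.1))
  simp only [← Finset.sum_mul] at h1
  exact h1.trans (by gcongr; linarith)

/-! ### The receiver-side and transmitter-side bounds -/

namespace Scheme

variable {NT NR M N L : ℕ} {μR μT : ℝ} {S : Scheme NT NR M N L μR μT} {H : Channel NT NR M N}
  {l : EReal}

/-- Bound of the normalized delivery time by the number of dimensions of the signals that the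
first `s` receivers see. -/
theorem HasNDT.le_of_signal_dim (hl : S.HasNDT H l)
    (hS : ∀ᶠ P : ℝ≥0 in atTop, Tendsto (fun F : ℕ => (S P F).worstErrorProb H) atTop (𝓝 0))
    (hL : NR ≤ L) (hμR : 0 ≤ μR) {s : ℕ} (hs : 1 ≤ s) (hsNR : s ≤ NR)
    {κ : Type*} [Fintype κ] [Nonempty κ] (a : κ → Fin NR × Fin N → ℂ) {c : ℝ} (hc : 1 ≤ c)
    (hsig : ∀ P F, ∀ d : Demand NR L, ∃ u : Library L F → Fin ((S P F).T d H) × κ → ℂ,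
      (∀ W p, ‖u W p‖ ≤ c * √P) ∧ ∀ W (j : Fin NR), j.val < s → ∀ n t,
        (S P F).signal d H W (j, n, t) = ∑ q, a q (j, n) * u W (t, q)) :
    ((s * (1 - s * μR) / Fintype.card κ : ℝ) : EReal) ≤ l := by
  refine hl.le_of_converse (c₀ := NR * N * Real.logb 2 (shiftCost (2 * ∑ q, ∑ p, ‖a q p‖)) +
    Fintype.card κ * Real.logb 2 (25 * c ^ 2)) (by exact_mod_cast Fintype.card_pos) ?_
  filter_upwards [hS, eventually_ge_atTop 1] with P hP hP1
  have hpos : (0 : ℝ≥0∞) < ((2 * NR : ℕ) : ℝ≥0∞)⁻¹ :=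
    ENNReal.inv_pos.2 (ENNReal.natCast_ne_top _)
  filter_upwards [hP.eventually_le_const hpos] with F hF
  refine le_trans (le_of_eq ?_) ((S P F).converse H hL hμR hs hsNR hP1 hF a hc (hsig P F))
  ring

/-- A single receiver sees only `N` complex numbers per slot, so its own noiseless outputs serve as
coordinates and `a` merely selects one of them. -/
theorem HasNDT.receive_bound (hl : S.HasNDT H l)
    (hS : ∀ᶠ P : ℝ≥0 in atTop, Tendsto (fun F : ℕ => (S P F).worstErrorProb H) atTop (𝓝 0))
    (hL : NR ≤ L) (hμR : 0 ≤ μR) (hNR : 1 ≤ NR) (hN : 1 ≤ N) :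
    (((1 / (N : ℝ)) * (1 - μR) : ℝ) : EReal) ≤ l := by
  classical
  have : Nonempty (Fin N) := ⟨⟨0, hN⟩⟩
  have h := hl.le_of_signal_dim hS hL hμR le_rfl hNR
    (κ := Fin N) (fun q p => if p.2 = q then 1 else 0)
    (c := 1 + ∑ i, ∑ m, ∑ j, ∑ n, ‖H (j, i, n, m)‖)
    (le_add_of_nonneg_right (by positivity)) fun P F d =>
      ⟨fun W p => (S P F).signal d H W (⟨0, hNR⟩, p.2, p.1),
        fun W p => (S P F).norm_signal_le d H W _, fun W j hj n t => by
          have : j = ⟨0, hNR⟩ := Fin.ext (by simpa using hj)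
          subst this
          simp⟩
  convert h using 2
  simp
  ring

/-- However many receivers are active, their signals are linear images of the N_T M antenna inputs.
Here `a` is the channel itself, and the power constraint gives amplitude constant 1. -/
theorem HasNDT.transmit_bound (hl : S.HasNDT H l)
    (hS : ∀ᶠ P : ℝ≥0 in atTop, Tendsto (fun F : ℕ => (S P F).worstErrorProb H) atTop (𝓝 0))
    (hL : NR ≤ L) (hμR : 0 ≤ μR) {s : ℕ} (hs : 1 ≤ s) (hsNR : s ≤ NR) (hNT : 1 ≤ NT)
    (hM : 1 ≤ M) :
    (((s : ℝ) / ((NT : ℝ) * (M : ℝ)) * (1 - (s : ℝ) * μR) : ℝ) : EReal) ≤ l := by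
  have : Nonempty (Fin NT × Fin M) := ⟨(⟨0, hNT⟩, ⟨0, hM⟩)⟩
  have h := hl.le_of_signal_dim hS hL hμR hs hsNR
    (κ := Fin NT × Fin M) (fun q p => H (p.1, q.1, p.2, q.2)) le_rfl fun P F d =>
      ⟨fun W p => (S P F).enc p.2.1 ((S P F).txCache p.2.1 W) d H p.1 p.2.2,
        fun W p => by rw [one_mul]; exact (S P F).norm_enc_le _ _ _ _ _ _,
        fun W j _ n t => by simp [Code.signal, Fintype.sum_prod_type]⟩
  convert h using 2
  simp
  ring

end Scheme

end CacheMIMO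

theorem theorem3 (NT NR M N L : ℕ) (hNT : 1 ≤ NT) (hNR : 1 ≤ NR) (hM : 1 ≤ M) (hN : 1 ≤ N)
    (hL : NR ≤ L) (μR μT : ℝ) (hμR : 0 ≤ μR) (hμR' : μR ≤ 1) (hμT : 0 ≤ μT) (hμT' : μT ≤ 1)
    (hμ : 1 ≤ μR + (NT : ℝ) * μT)
    (ν : MeasureTheory.Measure ℂ) [MeasureTheory.IsProbabilityMeasure ν]
    [MeasureTheory.NullSingletonClass ν] :
    ((max ((1 / (N : ℝ)) * (1 - μR))
        ((Finset.Icc 1 NR).sup' (Finset.nonempty_Icc.mpr hNR)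
          (fun s : ℕ => ((s : ℝ) / ((NT : ℝ) * (M : ℝ))) * (1 - (s : ℝ) * μR))) : ℝ) : EReal) ≤
      CacheMIMO.minNDT NT NR M N L μR μT ν := by
  refine le_sInf fun τ hτ => ?_
  obtain ⟨S, hS, hndt⟩ := hτ
  have : MeasureTheory.IsProbabilityMeasure (CacheMIMO.channelLaw NT NR M N ν) := by
    unfold CacheMIMO.channelLaw; infer_instance
  -- Both properties hold almost surely under a probability measure, so some channel has both, and
  -- one such channel suffices.
  obtain ⟨H, hH, l, hlτ, hl⟩ := (hS.and hndt).exists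
  refine le_trans ?_ hlτ
  rw [EReal.coe_strictMono.monotone.map_max]
  refine max_le (hl.receive_bound hH hL hμR hNR hN) ?_
  obtain ⟨s, hs, hmax⟩ := Finset.exists_mem_eq_sup' (Finset.nonempty_Icc.mpr hNR)
    (fun s : ℕ => ((s : ℝ) / ((NT : ℝ) * (M : ℝ))) * (1 - (s : ℝ) * μR))
  rw [hmax]
  rw [Finset.mem_Icc] at hs
  exact hl.transmit_bound hH hL hμR hs.1 hs.2 hNT hM
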